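/- Let $K$ be an integral domain containing $\mathbb{Q}$ as a subring, and let $f=z+f_2z^2+f_3z^3+\cdots\in zK[[z]]$ be a unitary formal power series (linear coefficient $1$). Let $t$ be an indeterminate over $K$. Let $[f]=([f]_{ij})_{i,j\ge 0}$ be the upper triangular matrix over $K$ whose entry $[f]_{ij}$ is the coefficient of $z^j$ in $f^i$; then $[f]-1$ is strictly upper triangular. The fractional iterate of $f$ is $$f^{[t]}=\sum_{j\ge 1}M_{1j}z^j\in zK[t][[z]],\qquad M=\sum_{n\ge 0}\binom{t}{n}([f]-1)^n,\quad \binom{t}{n}=\frac{t(t-1)\cdots(t-n+1)}{n!}$$ (equivalently, $f^{[t]}$ is the unique element of $zK[t][[z]]$ with $f^{[t]}|_{t=0}=z$ and $f^{[t]}|_{t=a+1}=(f^{[t]}|_{t=a})\circ f$ for all $a\in K$). The iterative logarithm of $f$ is $$f_*=\sum_{j\ge 1}L_{1j}z^j\in z^2K[[z]],\qquad L=\log[f]=\sum_{n\ge 1}\frac{(-1)^{n+1}}{n}([f]-1)^n$$ (equivalently, $f_*$ is the unique $h=\sum_n h_nz^n\in z^2K[[z]]$ such that $L_{ij}=i\,h_{j-i+1}$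 for all $1\le i\le j$). For a commutative ring $A$, equip $A[[z]]$ with the derivation $d/dz$. For a differential subring $R$ of $A[[z]]$, an element $y\in A[[z]]$ is called differentially algebraic over $R$ if there is a nonzero polynomial $P\in R[Y,Y',Y'',\dots]$ in the indeterminates $Y^{(n)}$ ($n\ge 0$) with $P(y,y',y'',\dots)=0$. Then the following are equivalent: 1. $f_*\in K[[z]]$ is differentially algebraic over $K[z]$; 2. $f^{[t]}\in K[t][[z]]$ is differentially algebraic over $K[z]$; 3. $f^{[t]}\in K[t][[z]]$ is differentially algebraic over $K[t][z]$; 4. $f^{[t]}\in K[t][[z]]$ is differentially algebraic over $K[t]$. -/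

import Mathlib

open scoped Polynomial PowerSeries

namespace FormalIteration

noncomputable section

/-- A power series `f = z + f₂ z² + ⋯` without constant term and with linear coefficient `1`. -/
def IsUnitary {K : Type*} [CommRing K] (f : K⟦X⟧) : Prop :=
  PowerSeries.coeff 0 f = 0 ∧ PowerSeries.coeff 1 f = 1

/-! ### Upper triangular `ℕ × ℕ` matrices -/

/-- Product of upper triangular matrices. The `(i, j)` entry is `∑ k, M i k * N k j`,
where the terms with `k > j` vanish because `N` is upper triangular. -/
def triMul {K : Type*} [CommRing K] (M N : Matrix ℕ ℕ K) : Matrix ℕ ℕ K :=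
  fun i j => ∑ k ∈ Finset.range (j + 1), M i k * N k j

/-- Powers of an upper triangular matrix. -/
def triPow {K : Type*} [CommRing K] (M : Matrix ℕ ℕ K) : ℕ → Matrix ℕ ℕ K
  | 0 => 1
  | n + 1 => triMul (triPow M n) M

/-- The logarithm `∑_{n ≥ 1} (-1)^(n+1) (M - 1)^n / n` of an upper triangular matrix `M` with
diagonal entries `1`. As `M - 1` is strictly upper triangular, the `(i, j)` entry of `(M - 1)^n`
vanishes for `n > j`, so that the sum may be cut off at `n = j`. -/
def triLog {K : Type*} [CommRing K] [Algebra ℚ K] (M : Matrix ℕ ℕ K) : Matrix ℕ ℕ K :=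
  fun i j => ∑ n ∈ Finset.Icc 1 j, ((-1 : ℚ) ^ (n + 1) / (n : ℚ)) • triPow (M - 1) n i j

/-- The binomial coefficient `t (t - 1) ⋯ (t - n + 1) / n!` as an element of `K[t]`. -/
def binomT (K : Type*) [CommRing K] [Algebra ℚ K] (n : ℕ) : K[X] :=
  ((n.factorial : ℚ)⁻¹) • descPochhammer K n

/-- The `t`-th power `M^t = ∑_{n ≥ 0} (t choose n) (M - 1)^n`, a matrix over `K[t]`, of an upper
triangular matrix `M` over `K` with diagonal entries `1`. The sum is cut off as in `triLog`. -/
def triPowT {K : Type*} [CommRing K] [Algebra ℚ K] (M : Matrix ℕ ℕ K) : Matrix ℕ ℕ K[X] :=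
  fun i j => ∑ n ∈ Finset.range (j + 1), Polynomial.C (triPow (M - 1) n i j) * binomT K n

/-! ### Iteration matrix, iterative logarithm and fractional iterate -/

/-- The iteration matrix of `f` (for the reference sequence `1, 1, 1, …`): its `i`-th row lists
the coefficients of `f ^ i`. -/
def iterMatrix {K : Type*} [CommRing K] (f : K⟦X⟧) : Matrix ℕ ℕ K :=
  fun i j => PowerSeries.coeff j (f ^ i)

/-- The iterative logarithm `f_*`. The logarithm of the iteration matrix of `f` is the matrix with
`(i, j)` entry `i * h_{j-i+1}` for a power series `h = f_*`, whose coefficients are therefore the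
entries of the row with index `1`. -/
def iterLog {K : Type*} [CommRing K] [Algebra ℚ K] (f : K⟦X⟧) : K⟦X⟧ :=
  PowerSeries.mk fun j => triLog (iterMatrix f) 1 j

/-- The fractional iterate `f^[t]`, a power series in `z` over `K[t]`: its coefficients are the
entries of the row with index `1` of the `t`-th power of the iteration matrix. -/
def fracIter {K : Type*} [CommRing K] [Algebra ℚ K] (f : K⟦X⟧) : K[X]⟦X⟧ :=
  PowerSeries.mk fun j => triPowT (iterMatrix f) 1 j

/-! ### Algebraic differential equations -/

/-- `y ∈ A⟦z⟧` is differentially algebraic over `R`, where `ι` embeds `R` into the differential ring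
`(A⟦z⟧, d/dz)` : there is a nonzero differential polynomial `P` over `R` in one differential
indeterminate `Y`, that is, a nonzero polynomial over `R` in the variables `Y, Y', Y'', …`
(indexed by `ℕ`), with `P(y, y', y'', …) = 0`. -/
def IsDiffAlgOver {R A : Type*} [CommRing R] [CommRing A] (ι : R →+* A⟦X⟧) (y : A⟦X⟧) : Prop :=
  ∃ P : MvPolynomial ℕ R, P ≠ 0 ∧
    MvPolynomial.eval₂ ι (fun n => (PowerSeries.derivative A)^[n] y) P = 0

/-- The embedding `A → A⟦z⟧` as constant power series. -/
def constEmb (A : Type*) [CommRing A] : A →+* A⟦X⟧ := PowerSeries.C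

/-- The embedding `A[z] → A⟦z⟧`. -/
def polyEmb (A : Type*) [CommRing A] : A[X] →+* A⟦X⟧ :=
  Polynomial.coeToPowerSeries.ringHom

/-- The embedding `K[z] → K[t]⟦z⟧` (coefficients in `K` become constant polynomials in `t`). -/
def polyEmbT (K : Type*) [CommRing K] : K[X] →+* K[X]⟦X⟧ :=
  (polyEmb K[X]).comp (Polynomial.mapRingHom Polynomial.C)

end

end FormalIteration

namespace FormalIteration

noncomputable section

/-! ### Relative algebraic closures of finitely generated subalgebras -/

/-! Write F = f^[t], h = f_*, with ' for d/dz. Since z and t are themselves differentially algebraic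
over K, each of the four conditions amounts to algebraic dependence over K of the derivatives of h
or of F. Such dependence is handled through finite sets S whose relative algebraic closure `acl K S`
is stable under d/dz (`exists_stable_of_isDiffAlgOver`, `not_algebraicIndependent_of_stable`).

The link between h and F is the flow equation ∂F/∂t = h·F' = h∘F (`derivT_fracIter`,
`derivT_fracIter_eq_subst`), which comes from differentiating M^(s+N) = M^s M^N = M^N M^s at s = 0.

From h to F: if h ≠ 0, then F' = (h∘F)/h, so F, finitely many derivatives of h and their composites
with F have a stable closure. From F to h: let F^(n) be algebraic over the lower derivatives of F,
and apply ∂/∂t to this relation. As ∂F^(i)/∂t = (hF')^(i) equals h^(i)F' plus terms in lower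
derivatives of h, the derivative h^(n) is algebraic over the lower ones and derivatives of F. -/

theorem exists_isAlgebraic_of_not_algebraicIndependent {R B : Type*} [CommRing R] [CommRing B]
    [Algebra R B]
    (hinj : Function.Injective (algebraMap R B)) {x : ℕ → B} (hx : ¬ AlgebraicIndependent R x) :
    ∃ n, IsAlgebraic (Algebra.adjoin R (x '' Set.Iio n)) (x n) := by
  by_contra! hcon
  apply hx
  -- Independence has finite character, so initial segments suffice; each grows by an element
  -- transcendental over its predecessors.
  have hIio : ∀ n, AlgebraicIndepOn R x (Set.Iio n) := by
    intro n
    induction n with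
    | zero =>
      have : IsEmpty (Set.Iio 0) := by simp
      exact algebraicIndependent_empty_type_iff.2 hinj
    | succ n ih =>
      rw [← Order.succ_eq_add_one, Order.Iio_succ_eq_insert]
      exact ih.insert (hcon n)
  refine algebraicIndependent_of_finite_type fun t ht => ?_
  obtain ⟨n, hn⟩ := ht.bddAbove
  exact (hIio (n + 1)).mono fun i hi => Nat.lt_succ_of_le (hn hi)

section AlgClosure

variable (K : Type*) {B : Type*} [CommRing K] [CommRing B] [IsDomain B] [Algebra K B]

/-- The elements of the domain `B` that are algebraic over the `K`-subalgebra generated by `S`. -/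
def acl (S : Set B) : Subalgebra K B :=
  (Subalgebra.algebraicClosure (Algebra.adjoin K S) B).restrictScalars K

variable {K}

theorem mem_acl {S : Set B} {x : B} : x ∈ acl K S ↔ IsAlgebraic (Algebra.adjoin K S) x :=
  Iff.rfl

theorem adjoin_le_acl (S : Set B) : Algebra.adjoin K S ≤ acl K S := fun x hx =>
  isAlgebraic_algebraMap (⟨x, hx⟩ : Algebra.adjoin K S)

theorem subset_acl (S : Set B) : S ⊆ acl K S :=
  Algebra.subset_adjoin.trans (adjoin_le_acl S)

theorem mem_acl_of_isAlgebraic {R : Type*} [CommRing R] [Algebra R B]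
    (hinj : Function.Injective (algebraMap R B)) {T : Set B}
    (hR : ∀ r : R, algebraMap R B r ∈ acl K T) {x : B} (hx : IsAlgebraic R x) :
    x ∈ acl K T := by
  obtain ⟨p, hp, hpx⟩ := hx
  let i : R →+* (Subalgebra.algebraicClosure (Algebra.adjoin K T) B) :=
    (algebraMap R B).codRestrict _ hR
  have hi : Function.Injective i := fun a b h => hinj (congrArg Subtype.val h)
  have : IsAlgebraic (Subalgebra.algebraicClosure (Algebra.adjoin K T) B) x := by
    refine ⟨p.map i, (Polynomial.map_ne_zero_iff hi).2 hp, ?_⟩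
    rw [Polynomial.aeval_def, Polynomial.eval₂_map]
    exact hpx
  exact mem_acl.2 (this.restrictScalars (Algebra.adjoin K T))

theorem acl_le_acl {S T : Set B} (h : S ⊆ acl K T) : acl K S ≤ acl K T := fun _ hx =>
  mem_acl_of_isAlgebraic (R := Algebra.adjoin K S) Subtype.val_injective
    (fun r => Algebra.adjoin_le h r.2) (mem_acl.1 hx)

theorem mem_acl_of_mul_mem {T : Set B} {a x : B} (ha : a ∈ acl K T) (h0 : a ≠ 0)
    (h : a * x ∈ acl K T) : x ∈ acl K T :=
  IsAlgebraic.of_mul (mem_nonZeroDivisors_of_ne_zero h0) ha (mul_comm a x ▸ h)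

/-- A derivation maps the relative algebraic closure of `S` into that of `T` as soon as it does so
for the generators. -/
theorem derivation_mem_acl [CharZero B] (d : Derivation K B B) {S T : Set B} (hST : S ⊆ acl K T)
    (hd : ∀ s ∈ S, d s ∈ acl K T) {x : B} (hx : x ∈ acl K S) : d x ∈ acl K T := by
  have hadj : ∀ a ∈ Algebra.adjoin K S, d a ∈ acl K T := by
    intro a ha
    induction ha using Algebra.adjoin_induction with
    | mem s hs => exact hd s hs
    | algebraMap r => simp
    | add a b _ _ ha hb => simpa using add_mem ha hb
    | mul a b ha' hb' ha hb =>
      have h1 := Algebra.adjoin_le hST ha'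
      have h2 := Algebra.adjoin_le hST hb'
      simpa using add_mem (mul_mem h1 hb) (mul_mem h2 ha)
  have hxT : x ∈ acl K T := acl_le_acl hST hx
  classical
  have hex : ∃ n, ∃ p : (Algebra.adjoin K S)[X], p ≠ 0 ∧ Polynomial.aeval x p = 0 ∧
      p.natDegree = n := by
    obtain ⟨p, hp, hpx⟩ := mem_acl.1 hx
    exact ⟨_, p, hp, hpx, rfl⟩
  obtain ⟨p, hp, hpx, hdeg⟩ := Nat.find_spec hex
  have hchar : CharZero (Algebra.adjoin K S) :=
    (algebraMap (Algebra.adjoin K S) B).charZero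
  -- By minimality of the degree of p; characteristic zero excludes p' = 0.
  have hsep : Polynomial.aeval x (Polynomial.derivative p) ≠ 0 := by
    intro h
    by_cases hp' : Polynomial.derivative p = 0
    · have hc := Polynomial.eq_C_of_derivative_eq_zero hp'
      rw [hc, Polynomial.aeval_C] at hpx
      exact hp (by rw [hc, (map_eq_zero_iff _ Subtype.val_injective).1 hpx, Polynomial.C_0])
    · have hpos : p.natDegree ≠ 0 := fun h0 => hp' (by
        rw [Polynomial.eq_C_of_natDegree_eq_zero h0, Polynomial.derivative_C])
      exact Nat.find_min hex (hdeg ▸ Polynomial.natDegree_derivative_lt hpos) ⟨_, hp', h, rfl⟩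
  have hcoef : ∑ n ∈ p.support, d ((p.coeff n : B)) * x ^ n ∈ acl K T :=
    sum_mem fun n _ => mul_mem (hadj _ (p.coeff n).2) (pow_mem hxT n)
  have hsepT : Polynomial.aeval x (Polynomial.derivative p) ∈ acl K T := by
    rw [Polynomial.aeval_eq_sum_range]
    refine sum_mem fun n _ => ?_
    rw [Algebra.smul_def]
    exact mul_mem (Algebra.adjoin_le hST (Subtype.prop _)) (pow_mem hxT n)
  -- Apply d to p(x) = 0; the sum is p with d applied to its coefficients, evaluated at x.
  have key : Polynomial.aeval x (Polynomial.derivative p) * d x +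
      ∑ n ∈ p.support, d ((p.coeff n : B)) * x ^ n = 0 := by
    have h0 := congrArg d hpx
    rw [Polynomial.aeval_def, Polynomial.eval₂_eq_sum, Polynomial.sum, map_sum, map_zero] at h0
    rw [← h0, Polynomial.derivative_apply, Polynomial.sum, map_sum, Finset.sum_mul,
      ← Finset.sum_add_distrib]
    refine Finset.sum_congr rfl fun n _ => ?_
    rw [Derivation.leibniz, Derivation.leibniz_pow]
    simp only [map_mul, map_natCast, Polynomial.aeval_C, Polynomial.aeval_X, map_pow,
      smul_eq_mul, nsmul_eq_mul]
    change _ = algebraMap (Algebra.adjoin K S) B _ * _ + x ^ n * d (algebraMap _ B (p.coeff n))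
    change _ + d (algebraMap (Algebra.adjoin K S) B (p.coeff n)) * _ = _
    ring
  refine mem_acl_of_mul_mem hsepT hsep ?_
  rw [eq_neg_of_add_eq_zero_left key]
  exact neg_mem hcoef

theorem iterate_derivation_mem_acl [CharZero B] (d : Derivation K B B) {S : Set B}
    (hd : ∀ s ∈ S, d s ∈ acl K S) {x : B} (hx : x ∈ acl K S) (n : ℕ) : d^[n] x ∈ acl K S := by
  induction n with
  | zero => exact hx
  | succ n ih =>
    rw [Function.iterate_succ_apply']
    exact derivation_mem_acl d (subset_acl S) hd ih

/-- In the matroid of algebraic independence the closure of S has rank at most |S|, so it contains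
no infinite independent family. -/
theorem not_algebraicIndependent_of_mem_acl [Nontrivial K] [FaithfulSMul K B] {S : Set B} (hS : S.Finite)
    {x : ℕ → B} (hx : ∀ n, x n ∈ acl K S) : ¬ AlgebraicIndependent K x := by
  intro hind
  let M := AlgebraicIndependent.matroid K B
  have hI : M.Indep (Set.range x) := hind.coe_range
  have hsub : Set.range x ⊆ M.closure S := by
    rw [AlgebraicIndependent.matroid_closure_eq]
    rintro _ ⟨n, rfl⟩
    exact hx n
  have h1 : M.eRk (Set.range x) ≤ M.eRk S := by
    rw [← M.eRk_closure_eq S]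
    exact M.eRk_mono hsub
  rw [hI.eRk_eq_encard] at h1
  have h2 := h1.trans (M.eRk_le_encard S)
  rw [(Set.infinite_range_of_injective (hind.injective)).encard_eq, top_le_iff,
    Set.encard_eq_top_iff] at h2
  exact h2 hS

end AlgClosure

/-! ### The fractional iterate as a flow -/

section Flow

open PowerSeries (coeff)

theorem coeff_linearMap_eq_sum {R : Type*} [CommRing R] (ψ : R⟦X⟧ →ₗ[R] R⟦X⟧) (j : ℕ)
    (hψ : ∀ r, coeff j (ψ (PowerSeries.X ^ (j + 1) * r)) = 0) (g : R⟦X⟧) :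
    coeff j (ψ g) = ∑ k ∈ Finset.range (j + 1),
      coeff k g * coeff j (ψ (PowerSeries.X ^ k)) := by
  conv_lhs => rw [PowerSeries.eq_X_pow_mul_shift_add_trunc (j + 1) g]
  have htr : ((PowerSeries.trunc (j + 1) g : R[X]) : R⟦X⟧) =
      ∑ k ∈ Finset.range (j + 1), coeff k g • PowerSeries.X ^ k := by
    ext n
    simp [PowerSeries.coeff_trunc, PowerSeries.coeff_X_pow]
  rw [map_add, map_add, hψ, zero_add, htr, map_sum, map_sum]
  simp

/-- No continuity is needed: multiples of X^(j+1) go to multiples of X^(j+1), so only the truncation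
of g matters. -/
theorem coeff_algHom_eq_sum {R : Type*} [CommRing R] (ψ : R⟦X⟧ →ₐ[R] R⟦X⟧)
    (hψ : PowerSeries.X ∣ ψ PowerSeries.X) (g : R⟦X⟧) (j : ℕ) :
    coeff j (ψ g) = ∑ k ∈ Finset.range (j + 1),
      coeff k g * coeff j (ψ PowerSeries.X ^ k) := by
  rw [← AlgHom.toLinearMap_apply, coeff_linearMap_eq_sum]
  · simp
  · intro r
    have : PowerSeries.X ^ (j + 1) ∣ ψ (PowerSeries.X ^ (j + 1) * r) := by
      rw [map_mul, map_pow]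
      exact (pow_dvd_pow_of_dvd hψ _).mul_right _
    exact PowerSeries.X_pow_dvd_iff.1 this j j.lt_succ_self

theorem coeff_mul_derivative_eq_sum {R : Type*} [CommRing R] {h : R⟦X⟧} (hh : PowerSeries.X ∣ h)
    (g : R⟦X⟧) (j : ℕ) :
    coeff j (h * PowerSeries.derivative R g) = ∑ k ∈ Finset.range (j + 1),
      coeff k g * coeff j (h * PowerSeries.derivative R (PowerSeries.X ^ k)) := by
  refine coeff_linearMap_eq_sum
    (LinearMap.mulLeft R h ∘ₗ (PowerSeries.derivative R).toLinearMap) j (fun r => ?_) g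
  obtain ⟨u, rfl⟩ := hh
  refine (PowerSeries.X_pow_dvd_iff (n := j + 1)).1 ⟨((j + 1 : ℕ) : R⟦X⟧) * u * r +
    PowerSeries.X * u * PowerSeries.derivative R r, ?_⟩ j j.lt_succ_self
  change PowerSeries.X * u * PowerSeries.derivative R (PowerSeries.X ^ (j + 1) * r) = _
  rw [Derivation.leibniz, Derivation.leibniz_pow, PowerSeries.derivative_X]
  simp only [smul_eq_mul, nsmul_eq_mul, Nat.add_sub_cancel]
  ring

theorem map_derivative {R S : Type*} [CommRing R] [CommRing S] (φ : R →+* S) (g : R⟦X⟧) :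
    PowerSeries.map φ (PowerSeries.derivative R g) =
      PowerSeries.derivative S (PowerSeries.map φ g) := by
  ext n
  simp [PowerSeries.coeff_derivative]

theorem hasSubst_of_X_dvd {R : Type*} [CommRing R] {F : R⟦X⟧} (hF : PowerSeries.X ∣ F) :
    PowerSeries.HasSubst F :=
  PowerSeries.HasSubst.of_constantCoeff_zero' (PowerSeries.X_dvd_iff.1 hF)

/-- Composition with `F` on the right. -/
def substHom {R : Type*} [CommRing R] {F : R⟦X⟧} (hF : PowerSeries.X ∣ F) : R⟦X⟧ →ₐ[R] R⟦X⟧ :=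
  PowerSeries.substAlgHom (hasSubst_of_X_dvd hF)

theorem substHom_X {R : Type*} [CommRing R] {F : R⟦X⟧} (hF : PowerSeries.X ∣ F) :
    substHom hF PowerSeries.X = F :=
  PowerSeries.substAlgHom_X _

theorem coeff_substHom {R : Type*} [CommRing R] {F : R⟦X⟧} (hF : PowerSeries.X ∣ F) (g : R⟦X⟧)
    (j : ℕ) : coeff j (substHom hF g) = ∑ k ∈ Finset.range (j + 1),
      coeff k g * coeff j (F ^ k) := by
  rw [coeff_algHom_eq_sum _ (by rw [substHom_X]; exact hF), substHom_X]

theorem derivative_substHom {R : Type*} [CommRing R] {F : R⟦X⟧} (hF : PowerSeries.X ∣ F)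
    (g : R⟦X⟧) : PowerSeries.derivative R (substHom hF g) =
      substHom hF (PowerSeries.derivative R g) * PowerSeries.derivative R F := by
  simpa [substHom, PowerSeries.coe_substAlgHom] using
    PowerSeries.derivative_subst (f := g) (hasSubst_of_X_dvd hF)

/-- Reduces identities in t to t = N, where F is the N-fold iterate of f. -/
theorem polynomial_ext_natCast {K : Type*} [CommRing K] [IsDomain K] [CharZero K] {p q : K[X]}
    (h : ∀ n : ℕ, p.eval (n : K) = q.eval (n : K)) : p = q := by
  refine Polynomial.eq_of_infinite_eval_eq p q
    ((Set.infinite_range_of_injective (Nat.cast_injective (R := K))).mono ?_)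
  rintro _ ⟨n, rfl⟩
  exact h n

/-- The derivation `∂/∂t` of `K[t]⟦z⟧`. -/
def derivT (K : Type*) [CommRing K] : Derivation K K[X]⟦X⟧ K[X]⟦X⟧ :=
  Derivation.mk'
    { toFun := fun g => PowerSeries.mk fun n => Polynomial.derivative (coeff n g)
      map_add' := fun a b => by ext1 n; simp
      map_smul' := fun r a => by ext1 n; simp }
    (fun a b => by
      ext1 n
      simp only [LinearMap.coe_mk, AddHom.coe_mk, PowerSeries.coeff_mk, PowerSeries.coeff_mul,
        Polynomial.derivative_sum, Polynomial.derivative_mul, smul_eq_mul, map_add,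
        Finset.sum_add_distrib]
      rw [add_comm]
      congr 1
      rw [← Finset.Nat.sum_antidiagonal_swap]
      exact Finset.sum_congr rfl fun x _ => mul_comm _ _)

@[simp]
theorem coeff_derivT {K : Type*} [CommRing K] (g : K[X]⟦X⟧) (n : ℕ) :
    coeff n (derivT K g) = Polynomial.derivative (coeff n g) := by
  simp [derivT]

theorem derivT_derivative {K : Type*} [CommRing K] (g : K[X]⟦X⟧) :
    derivT K (PowerSeries.derivative K[X] g) = PowerSeries.derivative K[X] (derivT K g) := by
  ext1 n
  simp only [coeff_derivT, PowerSeries.coeff_derivative, Polynomial.derivative_mul]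
  simp

variable {K : Type*} [CommRing K]

section Binomial

variable [Algebra ℚ K]

theorem eval_natCast_binomT (n N : ℕ) : (binomT K n).eval (N : K) = N.choose n := by
  rw [binomT, Polynomial.eval_smul, descPochhammer_eval_eq_descFactorial,
    Nat.descFactorial_eq_factorial_mul_choose, Nat.cast_mul, ← nsmul_eq_mul,
    ← Nat.cast_smul_eq_nsmul ℚ, smul_smul,
    inv_mul_cancel₀ (Nat.cast_ne_zero.2 n.factorial_ne_zero), one_smul]

theorem eval_zero_derivative_binomT (n : ℕ) :
    (Polynomial.derivative (binomT K (n + 1))).eval 0 =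
      algebraMap ℚ K ((-1 : ℚ) ^ (n + 2) / ((n + 1 : ℕ) : ℚ)) := by
  -- The falling factorial of length n + 1 is t times that of length n at t - 1, so its derivative
  -- at 0 is the latter's value at -1.
  have h : ∀ n : ℕ, (descPochhammer K n).eval (-1) = algebraMap ℚ K ((-1) ^ n * n.factorial) := by
    intro n
    induction n with
    | zero => simp
    | succ n ih =>
      rw [descPochhammer_succ_eval, ih, Nat.factorial_succ]
      simp only [map_mul, map_pow, map_neg, map_one, map_natCast]
      push_cast
      ring
  have h1 : ((n.factorial : ℚ)) ≠ 0 := Nat.cast_ne_zero.2 n.factorial_ne_zero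
  have h2 : ((n : ℚ) + 1) ≠ 0 := by positivity
  rw [binomT, Polynomial.derivative_smul, Polynomial.eval_smul, descPochhammer_succ_left]
  simp only [Polynomial.derivative_mul, Polynomial.derivative_X, one_mul, Polynomial.eval_add,
    Polynomial.eval_mul, Polynomial.eval_X, zero_mul, add_zero, Polynomial.eval_comp,
    Polynomial.eval_sub, Polynomial.eval_one, zero_sub, h]
  rw [Algebra.smul_def, ← map_mul]
  congr 1
  rw [Nat.factorial_succ]
  push_cast
  field_simp
  ring

end Binomial

/-! ### Matrix powers as iterates of composition with f -/

variable {f : K⟦X⟧}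

theorem IsUnitary.X_dvd (hf : IsUnitary f) : PowerSeries.X ∣ f :=
  PowerSeries.X_dvd_iff.2 (by simpa using hf.1)

/-- The operator `g ↦ g ∘ f - g`. -/
def compDiff (hf : IsUnitary f) : Module.End K K⟦X⟧ := (substHom hf.X_dvd).toLinearMap - 1

theorem X_dvd_substHom_pow_X (hf : IsUnitary f) (N : ℕ) :
    PowerSeries.X ∣ (substHom hf.X_dvd ^ N) PowerSeries.X := by
  induction N with
  | zero => simp
  | succ N ih =>
    rw [pow_succ', AlgHom.mul_apply]
    exact ((hf.X_dvd).trans (substHom_X hf.X_dvd).symm.dvd).trans (map_dvd (substHom hf.X_dvd) ih)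

theorem coeff_compDiff (hf : IsUnitary f) (g : K⟦X⟧) (j : ℕ) :
    coeff j (compDiff hf g) = ∑ k ∈ Finset.range (j + 1),
      coeff k g * (iterMatrix f - 1) k j := by
  rw [compDiff, LinearMap.sub_apply, map_sub, AlgHom.toLinearMap_apply, coeff_substHom]
  simp [iterMatrix, mul_sub, Finset.sum_sub_distrib, Matrix.one_apply]

theorem triPow_eq_coeff (hf : IsUnitary f) (n i j : ℕ) :
    triPow (iterMatrix f - 1) n i j = coeff j ((compDiff hf ^ n) (PowerSeries.X ^ i)) := by
  induction n generalizing j with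
  | zero => simp [triPow, Matrix.one_apply, PowerSeries.coeff_X_pow, eq_comm]
  | succ n ih =>
    rw [pow_succ', Module.End.mul_apply, coeff_compDiff]
    simp only [triPow, triMul, ih]

/-- As [f] - 1 has zero diagonal, each application of `compDiff` raises the order; this justifies
the cut-offs at j. -/
theorem coeff_compDiff_pow_eq_zero (hf : IsUnitary f) (g : K⟦X⟧) {n j : ℕ} (i : ℕ)
    (hg : PowerSeries.X ^ i ∣ g) (hj : j < i + n) : coeff j ((compDiff hf ^ n) g) = 0 := by
  obtain ⟨v, hv⟩ := hf.X_dvd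
  have hv1 : PowerSeries.constantCoeff v = 1 := by
    have := hf.2
    rw [hv, ← zero_add 1, PowerSeries.coeff_succ_X_mul] at this
    simpa using this
  have hdiag : ∀ k, (iterMatrix f - 1) k k = 0 := by
    intro k
    have := PowerSeries.coeff_X_pow_mul (v ^ k) k 0
    rw [zero_add, PowerSeries.coeff_zero_eq_constantCoeff_apply, map_pow, hv1, one_pow] at this
    rw [Matrix.sub_apply, Matrix.one_apply_eq, iterMatrix, hv, mul_pow, this, sub_self]
  induction n generalizing j with
  | zero => exact PowerSeries.X_pow_dvd_iff.1 hg j hj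
  | succ n ih =>
    rw [pow_succ', Module.End.mul_apply, coeff_compDiff]
    refine Finset.sum_eq_zero fun k hk => ?_
    rcases (Finset.mem_range_succ_iff.1 hk).lt_or_eq with h | rfl
    · rw [ih (by omega), zero_mul]
    · rw [hdiag, mul_zero]

variable [Algebra ℚ K]

theorem eval_natCast_triPowT (hf : IsUnitary f) (i j N : ℕ) :
    (triPowT (iterMatrix f) i j).eval (N : K) =
      coeff j ((substHom hf.X_dvd ^ N) (PowerSeries.X ^ i)) := by
  have h1 : (substHom hf.X_dvd ^ N).toLinearMap = ∑ n ∈ Finset.range (N + 1),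
      (N.choose n : Module.End K K⟦X⟧) * compDiff hf ^ n := by
    have : (substHom hf.X_dvd).toLinearMap = compDiff hf + 1 := by rw [compDiff, sub_add_cancel]
    have h2 : (substHom hf.X_dvd ^ N).toLinearMap = (substHom hf.X_dvd).toLinearMap ^ N :=
      map_pow (AlgHom.toEnd) _ _
    rw [h2, this, (Commute.one_right _).add_pow]
    refine Finset.sum_congr rfl fun n _ => ?_
    rw [one_pow, mul_one, (Nat.cast_commute _ _).eq]
  rw [← AlgHom.toLinearMap_apply, h1, triPowT, Polynomial.eval_finsetSum, LinearMap.sum_apply,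
    map_sum]
  simp only [Polynomial.eval_mul, Polynomial.eval_C, eval_natCast_binomT, triPow_eq_coeff hf]
  -- The definition stops at j and the binomial theorem at N; both sums extend by zeros to a common
  -- range.
  have hl := Finset.sum_subset (s₁ := Finset.range (j + 1)) (s₂ := Finset.range (j + 1 + N))
    (f := fun n => coeff j ((compDiff hf ^ n) (PowerSeries.X ^ i)) * (N.choose n : K))
    (Finset.range_mono (by omega)) fun n _ hn => by
      rw [coeff_compDiff_pow_eq_zero hf _ i dvd_rfl (by simp at hn; omega), zero_mul]
  have hr := Finset.sum_subset (s₁ := Finset.range (N + 1)) (s₂ := Finset.range (j + 1 + N))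
    (f := fun n => coeff j ((compDiff hf ^ n) (PowerSeries.X ^ i)) * (N.choose n : K))
    (Finset.range_mono (by omega)) fun n _ hn => by
      rw [Nat.choose_eq_zero_of_lt (by simp at hn; omega), Nat.cast_zero, mul_zero]
  rw [hl, ← hr]
  refine Finset.sum_congr rfl fun n _ => ?_
  rw [Module.End.mul_apply, Module.End.natCast_apply, map_nsmul, nsmul_eq_mul, mul_comm]

theorem triLog_eq_eval_derivative (M : Matrix ℕ ℕ K) (i j : ℕ) :
    triLog M i j = (Polynomial.derivative (triPowT M i j)).eval 0 := by
  rw [triPowT, Polynomial.derivative_sum, Polynomial.eval_finsetSum, Finset.sum_range_succ',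
    triLog, ← Finset.Ico_add_one_right_eq_Icc, Finset.sum_Ico_eq_sum_range]
  have h0 : Polynomial.derivative (binomT K 0) = 0 := by simp [binomT]
  simp only [Polynomial.derivative_C_mul, Polynomial.eval_C_mul, h0, Polynomial.eval_zero,
    mul_zero, add_zero, eval_zero_derivative_binomT, Nat.add_sub_cancel]
  refine Finset.sum_congr rfl fun n _ => ?_
  rw [Algebra.smul_def, mul_comm, add_comm 1 n]

theorem map_eval_fracIter (hf : IsUnitary f) (N : ℕ) :
    PowerSeries.map (Polynomial.evalRingHom (N : K)) (fracIter f) =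
      (substHom hf.X_dvd ^ N) PowerSeries.X := by
  ext j
  rw [PowerSeries.coeff_map, fracIter, PowerSeries.coeff_mk, Polynomial.coe_evalRingHom,
    eval_natCast_triPowT hf, pow_one]

theorem map_eval_zero_fracIter (hf : IsUnitary f) :
    PowerSeries.map (Polynomial.evalRingHom (0 : K)) (fracIter f) = PowerSeries.X := by
  simpa using map_eval_fracIter hf 0

theorem map_eval_zero_derivT_fracIter (f : K⟦X⟧) :
    PowerSeries.map (Polynomial.evalRingHom (0 : K)) (derivT K (fracIter f)) = iterLog f := by
  ext j
  simp [iterLog, fracIter, triLog_eq_eval_derivative]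

theorem eval_triPowT_add (hf : IsUnitary f) (i j m N : ℕ) :
    (triPowT (iterMatrix f) i j).eval ((m + N : ℕ) : K) =
      ∑ k ∈ Finset.range (j + 1), (triPowT (iterMatrix f) i k).eval (m : K) *
        (triPowT (iterMatrix f) k j).eval (N : K) := by
  simp only [eval_natCast_triPowT hf]
  rw [add_comm, pow_add, AlgHom.mul_apply, coeff_algHom_eq_sum _ (X_dvd_substHom_pow_X hf N)]
  simp only [map_pow]

variable [IsDomain K]

/-- At t = N the matrix represents a ring homomorphism, which sends X^k to the k-th power of the
image of X. -/
theorem coeff_fracIter_pow (hf : IsUnitary f) (k j : ℕ) :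
    coeff j (fracIter f ^ k) = triPowT (iterMatrix f) k j := by
  have := algebraRat.charZero K
  refine polynomial_ext_natCast fun N => ?_
  rw [eval_natCast_triPowT hf, map_pow (substHom hf.X_dvd ^ N), ← map_eval_fracIter hf, ← map_pow, PowerSeries.coeff_map,
    Polynomial.coe_evalRingHom]

/-- Differentiating M^(s+N) = M^s M^N at s = 0 gives dM/dt = LM; the opposite order of factors gives
ML below. -/
theorem derivative_triPowT (hf : IsUnitary f) (i j : ℕ) :
    Polynomial.derivative (triPowT (iterMatrix f) i j) =
      ∑ k ∈ Finset.range (j + 1), Polynomial.C (triLog (iterMatrix f) i k) *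
        triPowT (iterMatrix f) k j := by
  have := algebraRat.charZero K
  refine polynomial_ext_natCast fun N => ?_
  have h : (triPowT (iterMatrix f) i j).comp (Polynomial.X + Polynomial.C (N : K)) =
      ∑ k ∈ Finset.range (j + 1), triPowT (iterMatrix f) i k *
        Polynomial.C ((triPowT (iterMatrix f) k j).eval (N : K)) := by
    refine polynomial_ext_natCast fun m => ?_
    have := eval_triPowT_add hf i j m N
    push_cast at this
    simpa [Polynomial.eval_finsetSum] using this
  have h' := congrArg (fun p => (Polynomial.derivative p).eval 0) h
  simpa [Polynomial.derivative_comp, Polynomial.eval_finsetSum, triLog_eq_eval_derivative,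
    Polynomial.eval_comp] using h'

theorem derivative_triPowT' (hf : IsUnitary f) (i j : ℕ) :
    Polynomial.derivative (triPowT (iterMatrix f) i j) =
      ∑ k ∈ Finset.range (j + 1), triPowT (iterMatrix f) i k *
        Polynomial.C (triLog (iterMatrix f) k j) := by
  have := algebraRat.charZero K
  refine polynomial_ext_natCast fun N => ?_
  have h : (triPowT (iterMatrix f) i j).comp (Polynomial.C (N : K) + Polynomial.X) =
      ∑ k ∈ Finset.range (j + 1), Polynomial.C ((triPowT (iterMatrix f) i k).eval (N : K)) *
        triPowT (iterMatrix f) k j := by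
    refine polynomial_ext_natCast fun m => ?_
    have := eval_triPowT_add hf i j N m
    push_cast at this
    simpa [Polynomial.eval_finsetSum] using this
  have h' := congrArg (fun p => (Polynomial.derivative p).eval 0) h
  simpa [Polynomial.derivative_comp, Polynomial.eval_finsetSum, triLog_eq_eval_derivative,
    Polynomial.eval_comp] using h'

/-- Row k of L is ∂(F^k)/∂t at t = 0, where F = z and ∂F/∂t = h. -/
theorem triLog_eq_coeff (hf : IsUnitary f) (k j : ℕ) :
    triLog (iterMatrix f) k j =
      coeff j (PowerSeries.derivative K (PowerSeries.X ^ k) * iterLog f) := by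
  rw [triLog_eq_eval_derivative, ← coeff_fracIter_pow hf, ← coeff_derivT,
    ← Polynomial.coe_evalRingHom, ← PowerSeries.coeff_map, Derivation.leibniz_pow,
    Derivation.leibniz_pow, map_nsmul, smul_eq_mul, map_mul, map_pow, map_eval_zero_fracIter hf,
    map_eval_zero_derivT_fracIter, PowerSeries.derivative_X]
  simp [mul_assoc]

/-- The equation `∂f^[t]/∂t = f_* · ∂f^[t]/∂z`. -/
theorem derivT_fracIter (hf : IsUnitary f) :
    derivT K (fracIter f) = PowerSeries.map Polynomial.C (iterLog f) *
      PowerSeries.derivative K[X] (fracIter f) := by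
  ext1 j
  have hX : PowerSeries.X ∣ PowerSeries.map (Polynomial.C (R := K)) (iterLog f) := by
    simp [PowerSeries.X_dvd_iff, ← PowerSeries.coeff_zero_eq_constantCoeff_apply, iterLog, triLog]
  rw [coeff_mul_derivative_eq_sum hX, coeff_derivT, fracIter, PowerSeries.coeff_mk,
    derivative_triPowT' hf]
  refine Finset.sum_congr rfl fun k _ => ?_
  rw [PowerSeries.coeff_mk, triLog_eq_coeff hf, ← PowerSeries.coeff_map, map_mul,
    map_derivative, map_pow, PowerSeries.map_X, mul_comm (PowerSeries.derivative _ _)]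

theorem X_dvd_fracIter (hf : IsUnitary f) : PowerSeries.X ∣ fracIter f := by
  have := algebraRat.charZero K
  rw [PowerSeries.X_dvd_iff, ← PowerSeries.coeff_zero_eq_constantCoeff_apply]
  refine polynomial_ext_natCast fun N => ?_
  rw [← Polynomial.coe_evalRingHom, ← PowerSeries.coeff_map, map_eval_fracIter hf,
    PowerSeries.coeff_zero_eq_constantCoeff_apply,
    PowerSeries.X_dvd_iff.1 (X_dvd_substHom_pow_X hf N), map_zero]

/-- The equation `∂f^[t]/∂t = f_* ∘ f^[t]`. -/
theorem derivT_fracIter_eq_subst (hf : IsUnitary f) :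
    derivT K (fracIter f) =
      substHom (X_dvd_fracIter hf) (PowerSeries.map Polynomial.C (iterLog f)) := by
  ext1 j
  rw [coeff_substHom, coeff_derivT]
  conv_lhs => rw [fracIter, PowerSeries.coeff_mk, derivative_triPowT hf]
  refine Finset.sum_congr rfl fun k _ => ?_
  rw [coeff_fracIter_pow hf, PowerSeries.coeff_map, iterLog, PowerSeries.coeff_mk]

end Flow

/-! ### Differentially algebraic power series -/

theorem IsDiffAlgOver.comp_injective {R R' A : Type*} [CommRing R] [CommRing R'] [CommRing A]
    {ι : R' →+* A⟦X⟧} {κ : R →+* R'} (hκ : Function.Injective κ) {y : A⟦X⟧}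
    (h : IsDiffAlgOver (ι.comp κ) y) : IsDiffAlgOver ι y := by
  obtain ⟨P, hP, hP0⟩ := h
  refine ⟨MvPolynomial.map κ P, fun h => hP (MvPolynomial.map_injective κ hκ (by simpa using h)),
    ?_⟩
  rw [MvPolynomial.eval₂_map]
  exact hP0

section DiffAlg

variable (K : Type*) {A : Type*} [CommRing K] [CommRing A] [Algebra K A]

/-- The derivation `d/dz` of `A⟦z⟧`, as a `K`-derivation for a subring `K` of `A`. -/
def derivZ (A : Type*) [CommRing A] [Algebra K A] : Derivation K A⟦X⟧ A⟦X⟧ :=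
  (PowerSeries.derivative A).restrictScalars K

theorem derivZ_apply (y : A⟦X⟧) : derivZ K A y = PowerSeries.derivative A y := rfl

variable {K}

theorem algebraMap_powerSeries_injective [FaithfulSMul K A] :
    Function.Injective (algebraMap K A⟦X⟧) := by
  intro a b h
  rw [PowerSeries.algebraMap_apply, PowerSeries.algebraMap_apply] at h
  exact FaithfulSMul.algebraMap_injective K A (PowerSeries.C_injective h)

instance faithfulSMul_powerSeries [FaithfulSMul K A] : FaithfulSMul K A⟦X⟧ :=
  (faithfulSMul_iff_algebraMap_injective K A⟦X⟧).2 algebraMap_powerSeries_injective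

instance charZero_powerSeries [CharZero A] : CharZero A⟦X⟧ :=
  charZero_of_injective_ringHom (f := PowerSeries.C (R := A)) PowerSeries.C_injective

variable (K A) in
/-- The extension of the structure map `K → A` to a map `K⟦z⟧ → A⟦z⟧`. -/
def mapEmb : K⟦X⟧ →ₐ[K] A⟦X⟧ :=
  { PowerSeries.map (algebraMap K A) with
    commutes' := fun r => by
      simp [PowerSeries.algebraMap_apply] }

variable (K) in
/-- The map `K⟦z⟧ → A⟦z⟧`, `g ↦ g ∘ F`. -/
def compEmb {F : A⟦X⟧} (hF : PowerSeries.X ∣ F) : K⟦X⟧ →ₐ[K] A⟦X⟧ :=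
  { (substHom hF).toRingHom.comp (PowerSeries.map (algebraMap K A)) with
    commutes' := fun r => by
      have := (substHom hF).commutes (algebraMap K A r)
      simpa [PowerSeries.algebraMap_apply] using this }

theorem derivZ_mapEmb (g : K⟦X⟧) : derivZ K A (mapEmb K A g) = mapEmb K A (derivZ K K g) :=
  (map_derivative _ g).symm

theorem iterate_derivZ_mapEmb (g : K⟦X⟧) (n : ℕ) :
    (derivZ K A)^[n] (mapEmb K A g) = mapEmb K A ((derivZ K K)^[n] g) :=
  ((Function.Semiconj.iterate_right (f := mapEmb K A) (fun g => (derivZ_mapEmb g).symm) n) g).symm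

theorem derivZ_compEmb {F : A⟦X⟧} (hF : PowerSeries.X ∣ F) (g : K⟦X⟧) :
    derivZ K A (compEmb K hF g) = compEmb K hF (derivZ K K g) * derivZ K A F := by
  change PowerSeries.derivative A (substHom hF (PowerSeries.map _ g)) = _
  rw [derivative_substHom, ← map_derivative]
  rfl

theorem mapEmb_injective [FaithfulSMul K A] : Function.Injective (mapEmb K A) :=
  PowerSeries.map_injective _ (FaithfulSMul.algebraMap_injective K A)

theorem isDiffAlgOver_of_not_algebraicIndependent {R : Type*} [CommRing R] {ι : R →+* A⟦X⟧}
    {κ : K →+* R} (hκ : Function.Injective κ) (hικ : ι.comp κ = algebraMap K A⟦X⟧) {y : A⟦X⟧}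
    (hy : ¬ AlgebraicIndependent K fun n => (derivZ K A)^[n] y) : IsDiffAlgOver ι y := by
  rw [algebraicIndependent_iff] at hy
  push Not at hy
  obtain ⟨P, hP, hP0⟩ := hy
  refine ⟨MvPolynomial.map κ P, fun h => hP0 (MvPolynomial.map_injective κ hκ (by simpa using h)),
    ?_⟩
  rw [MvPolynomial.eval₂_map, hικ]
  exact hP

variable [IsDomain A]

/-- The set c absorbs the base R; adjoining the derivatives of y below the first dependent one makes
the closure stable. -/
theorem exists_stable_of_isDiffAlgOver {R : Type*} [CommRing R] {ι : R →+* A⟦X⟧}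
    (hinj : Function.Injective ι) {c : Set A⟦X⟧} (hfin : c.Finite) (hι : ∀ r, ι r ∈ acl K c)
    (hc : ∀ s ∈ c, derivZ K A s ∈ acl K c) {y : A⟦X⟧} (hy : IsDiffAlgOver ι y) :
    ∃ S : Set A⟦X⟧, S.Finite ∧ (∀ s ∈ S, derivZ K A s ∈ acl K S) ∧ y ∈ acl K S := by
  let := ι.toAlgebra
  have hdep : ¬ AlgebraicIndependent R fun n => (derivZ K A)^[n] y := by
    rw [algebraicIndependent_iff]
    push Not
    obtain ⟨P, hP0, hP⟩ := hy
    exact ⟨P, hP, hP0⟩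
  obtain ⟨n, hn⟩ := exists_isAlgebraic_of_not_algebraicIndependent hinj hdep
  set S := c ∪ (fun i => (derivZ K A)^[i] y) '' Set.Iio n with hS
  have hcS : acl K c ≤ acl K S := acl_le_acl (Set.subset_union_left.trans (subset_acl S))
  have hnS : (derivZ K A)^[n] y ∈ acl K S := by
    refine mem_acl_of_isAlgebraic Subtype.val_injective (fun r => ?_) hn
    refine Algebra.adjoin_induction (p := fun x _ => x ∈ acl K S) (fun x hx => ?_) (fun r => ?_)
      (fun _ _ _ _ => add_mem) (fun _ _ _ _ => mul_mem) r.2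
    · exact subset_acl S (Or.inr hx)
    · exact hcS (hι r)
  have hle : ∀ i ≤ n, (derivZ K A)^[i] y ∈ acl K S := fun i hi => by
    rcases hi.lt_or_eq with h | rfl
    · exact subset_acl S (Or.inr ⟨i, h, rfl⟩)
    · exact hnS
  refine ⟨S, hfin.union ((Set.finite_Iio n).image _), ?_, hle 0 n.zero_le⟩
  rintro s (hs | ⟨i, hi, rfl⟩)
  · exact hcS (hc s hs)
  · rw [← Function.iterate_succ_apply' (derivZ K A)]
    exact hle (i + 1) hi

theorem not_algebraicIndependent_of_stable [Nontrivial K] [CharZero A] [FaithfulSMul K A]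
    {S : Set A⟦X⟧} (hS : S.Finite) (hd : ∀ s ∈ S, derivZ K A s ∈ acl K S) {y : A⟦X⟧}
    (hy : y ∈ acl K S) : ¬ AlgebraicIndependent K fun n => (derivZ K A)^[n] y :=
  not_algebraicIndependent_of_mem_acl hS (iterate_derivation_mem_acl (derivZ K A) hd hy)

end DiffAlg

/-- Leibniz rule modulo C: only the term with all n derivatives on a can leave C. -/
theorem iterate_derivation_mul_sub_mem {K B : Type*} [CommRing K] [CommRing B] [Algebra K B]
    (d : Derivation K B B) (C : Subalgebra K B) (n : ℕ) (a b : B) (ha : ∀ k < n, d^[k] a ∈ C)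
    (hb : ∀ k, d^[k] b ∈ C) : d^[n] (a * b) - d^[n] a * b ∈ C := by
  have hadd : ∀ (m : ℕ) (u v : B), d^[m] (u + v) = d^[m] u + d^[m] v := fun m =>
    iterate_map_add d m
  induction n generalizing a b with
  | zero => simp
  | succ n ih =>
    have h1 := ih (d a) b (fun k hk => ha (k + 1) (by omega)) hb
    have h2 := ih a (d b) (fun k hk => ha k (by omega)) fun k => hb (k + 1)
    have h3 := mul_mem (ha n n.lt_succ_self) (hb 1)
    have := add_mem (add_mem h1 h2) h3
    convert this using 1
    simp only [Function.iterate_succ_apply, Derivation.leibniz, smul_eq_mul, hadd,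
      Function.iterate_zero, id, mul_comm b]
    ring

section Main

variable {K : Type*} [CommRing K]

theorem coe_mem_adjoin_X (p : K[X]) :
    polyEmb K p ∈ Algebra.adjoin K {(PowerSeries.X : K⟦X⟧)} := by
  induction p using Polynomial.induction_on' with
  | add p q hp hq => simpa using add_mem hp hq
  | monomial n a =>
    have h1 : polyEmb K (Polynomial.monomial n a) =
        algebraMap K K⟦X⟧ a * PowerSeries.X ^ n := by
      simp [polyEmb, PowerSeries.monomial_eq_C_mul_X_pow]
    rw [h1]
    exact Subalgebra.mul_mem _ (Subalgebra.algebraMap_mem _ a)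
      (Subalgebra.pow_mem _ (Algebra.subset_adjoin (Set.mem_singleton _)) n)

theorem coe_mem_adjoin_X_t (p : K[X][X]) :
    polyEmb K[X] p ∈
      Algebra.adjoin K {(PowerSeries.X : K[X]⟦X⟧), PowerSeries.C (Polynomial.X : K[X])} := by
  induction p using Polynomial.induction_on' with
  | add p q hp hq => simpa using add_mem hp hq
  | monomial n a =>
    have h1 : polyEmb K[X] (Polynomial.monomial n a) = PowerSeries.C a * PowerSeries.X ^ n := by
      simp [polyEmb, PowerSeries.monomial_eq_C_mul_X_pow]
    rw [h1]
    clear h1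
    refine mul_mem ?_ (pow_mem (Algebra.subset_adjoin (by simp)) n)
    induction a using Polynomial.induction_on' with
    | add p q hp hq => simpa using add_mem hp hq
    | monomial m b =>
      have h2 : PowerSeries.C (Polynomial.monomial m b : K[X]) =
          algebraMap K K[X]⟦X⟧ b * PowerSeries.C (Polynomial.X : K[X]) ^ m := by
        rw [PowerSeries.algebraMap_apply, ← map_pow, ← map_mul, Polynomial.algebraMap_eq,
          Polynomial.C_mul_X_pow_eq_monomial]
      rw [h2]
      exact mul_mem (algebraMap_mem _ b) (pow_mem (Algebra.subset_adjoin (by simp)) m)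

theorem derivT_iterate_derivZ (g : K[X]⟦X⟧) (n : ℕ) :
    derivT K ((derivZ K K[X])^[n] g) = (derivZ K K[X])^[n] (derivT K g) :=
  (Function.Semiconj.iterate_right (f := derivT K) (fun g => derivT_derivative g) n) g

theorem polyEmb_C (a : K) : polyEmb K (Polynomial.C a) = PowerSeries.C a :=
  Polynomial.coe_C a

theorem polyEmbT_C (a : K) :
    polyEmbT K (Polynomial.C a) = PowerSeries.C (Polynomial.C a : K[X]) := by
  simp [polyEmbT, polyEmb_C]

theorem isDiffAlgOver_polyEmb_of_not_algebraicIndependent {y : K⟦X⟧}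
    (h : ¬ AlgebraicIndependent K fun n => (derivZ K K)^[n] y) : IsDiffAlgOver (polyEmb K) y :=
  isDiffAlgOver_of_not_algebraicIndependent (κ := Polynomial.C) Polynomial.C_injective
    (RingHom.ext polyEmb_C) h

theorem isDiffAlgOver_polyEmbT_of_not_algebraicIndependent {y : K[X]⟦X⟧}
    (h : ¬ AlgebraicIndependent K fun n => (derivZ K K[X])^[n] y) : IsDiffAlgOver (polyEmbT K) y :=
  isDiffAlgOver_of_not_algebraicIndependent (κ := Polynomial.C) Polynomial.C_injective
    (RingHom.ext fun a => (polyEmbT_C a).trans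
      (PowerSeries.algebraMap_apply (A := K[X])).symm) h

theorem isDiffAlgOver_constEmb_of_not_algebraicIndependent {y : K[X]⟦X⟧}
    (h : ¬ AlgebraicIndependent K fun n => (derivZ K K[X])^[n] y) :
    IsDiffAlgOver (constEmb K[X]) y :=
  isDiffAlgOver_of_not_algebraicIndependent (κ := Polynomial.C) Polynomial.C_injective
    (RingHom.ext fun _ => (PowerSeries.algebraMap_apply (A := K[X])).symm) h

theorem isDiffAlgOver_polyEmb_of_polyEmbT {y : K[X]⟦X⟧} (h : IsDiffAlgOver (polyEmbT K) y) :
    IsDiffAlgOver (polyEmb K[X]) y :=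
  IsDiffAlgOver.comp_injective (Polynomial.map_injective _ Polynomial.C_injective) h

theorem isDiffAlgOver_polyEmb_of_constEmb {y : K[X]⟦X⟧} (h : IsDiffAlgOver (constEmb K[X]) y) :
    IsDiffAlgOver (polyEmb K[X]) y := by
  have hc : constEmb K[X] = (polyEmb K[X]).comp Polynomial.C :=
    RingHom.ext fun a => (polyEmb_C a).symm
  rw [hc] at h
  exact IsDiffAlgOver.comp_injective Polynomial.C_injective h

/-! ### Transfer between f_* and f^[t] -/

variable [IsDomain K] [Algebra ℚ K] {f : K⟦X⟧}

theorem derivative_fracIter_ne_zero (hf : IsUnitary f) : derivZ K K[X] (fracIter f) ≠ 0 := by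
  intro h
  have h1 := congrArg (PowerSeries.map (Polynomial.evalRingHom (0 : K))) h
  rw [derivZ_apply, map_derivative, map_eval_zero_fracIter hf, PowerSeries.derivative_X,
    map_zero] at h1
  exact one_ne_zero h1

theorem fracIter_eq_X (hf : IsUnitary f) (h : iterLog f = 0) : fracIter f = PowerSeries.X := by
  have := algebraRat.charZero K
  have h1 := derivT_fracIter hf
  rw [h, map_zero, zero_mul] at h1
  have h2 := map_eval_zero_fracIter hf
  ext1 j
  have h3 := congrArg (PowerSeries.coeff j) h1
  rw [coeff_derivT, map_zero] at h3
  have h4 := Polynomial.eq_C_of_derivative_eq_zero h3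
  have h5 := congrArg (PowerSeries.coeff j) h2
  rw [PowerSeries.coeff_map, h4] at h5
  rw [h4]
  simp only [Polynomial.coe_evalRingHom, Polynomial.eval_C] at h5
  rw [h5, PowerSeries.coeff_X, PowerSeries.coeff_X]
  split_ifs <;> simp

theorem mapEmb_iterLog_mul (hf : IsUnitary f) :
    mapEmb K K[X] (iterLog f) * derivZ K K[X] (fracIter f) =
      compEmb K (X_dvd_fracIter hf) (iterLog f) :=
  (derivT_fracIter hf).symm.trans (derivT_fracIter_eq_subst hf)

theorem not_algebraicIndependent_fracIter (hf : IsUnitary f)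
    (h : ¬ AlgebraicIndependent K fun n => (derivZ K K)^[n] (iterLog f)) :
    ¬ AlgebraicIndependent K fun n => (derivZ K K[X])^[n] (fracIter f) := by
  have := algebraRat.charZero K
  -- The main argument divides by h.
  by_cases h0 : iterLog f = 0
  · rw [fracIter_eq_X hf h0]
    refine not_algebraicIndependent_of_stable (Set.finite_singleton PowerSeries.X) ?_
      (subset_acl _ rfl)
    rintro s rfl
    rw [derivZ_apply, PowerSeries.derivative_X]
    exact one_mem _
  have hu : ¬ AlgebraicIndependent K fun n => mapEmb K K[X] ((derivZ K K)^[n] (iterLog f)) :=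
    fun H => h (AlgebraicIndependent.of_comp (mapEmb K K[X]) H)
  have hw : ¬ AlgebraicIndependent K fun n => compEmb K (X_dvd_fracIter hf) ((derivZ K K)^[n] (iterLog f)) :=
    fun H => h (AlgebraicIndependent.of_comp (compEmb K (X_dvd_fracIter hf)) H)
  have hinj : Function.Injective (algebraMap K K[X]⟦X⟧) := algebraMap_powerSeries_injective
  obtain ⟨m, hm⟩ := exists_isAlgebraic_of_not_algebraicIndependent hinj hu
  obtain ⟨n, hn⟩ := exists_isAlgebraic_of_not_algebraicIndependent hinj hw
  set u := fun n => mapEmb K K[X] ((derivZ K K)^[n] (iterLog f)) with hu_def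
  set w := fun n => compEmb K (X_dvd_fracIter hf) ((derivZ K K)^[n] (iterLog f)) with hw_def
  set S := u '' Set.Iio m ∪ w '' Set.Iio n ∪ {fracIter f} with hS
  have hSu : ∀ i ≤ m, u i ∈ acl K S := fun i hi => by
    rcases hi.lt_or_eq with h | rfl
    · exact subset_acl S (Or.inl (Or.inl ⟨i, h, rfl⟩))
    · exact acl_le_acl (fun x hx => subset_acl S (Or.inl (Or.inl hx))) (mem_acl.2 hm)
  have hSw : ∀ i ≤ n, w i ∈ acl K S := fun i hi => by
    rcases hi.lt_or_eq with h | rfl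
    · exact subset_acl S (Or.inl (Or.inr ⟨i, h, rfl⟩))
    · exact acl_le_acl (fun x hx => subset_acl S (Or.inl (Or.inr hx))) (mem_acl.2 hn)
  have hF' : derivZ K K[X] (fracIter f) ∈ acl K S := by
    refine mem_acl_of_mul_mem (hSu 0 m.zero_le) ?_ ?_
    · exact (map_ne_zero_iff _ mapEmb_injective).2 h0
    · have : compEmb K (X_dvd_fracIter hf) (iterLog f) ∈ acl K S := hSw 0 n.zero_le
      rwa [← mapEmb_iterLog_mul hf] at this
  refine not_algebraicIndependent_of_stable (S := S) ?_ ?_ (subset_acl S (Or.inr rfl))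
  · exact (((Set.finite_Iio m).image _).union ((Set.finite_Iio n).image _)).union
      (Set.finite_singleton _)
  · rintro s ((⟨i, hi, rfl⟩ | ⟨i, hi, rfl⟩) | rfl)
    · have := hSu (i + 1) hi
      simp only [hu_def] at this
      rwa [Function.iterate_succ_apply', ← derivZ_mapEmb] at this
    -- Chain rule: (h^(i)∘F)' = (h^(i+1)∘F)·F'.
    · have := mul_mem (hSw (i + 1) hi) hF'
      simp only [hw_def] at this
      rwa [Function.iterate_succ_apply', ← derivZ_compEmb] at this
    · exact hF'

theorem not_algebraicIndependent_iterLog (hf : IsUnitary f) {S₀ : Set K[X]⟦X⟧}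
    (hfin : S₀.Finite) (hd : ∀ s ∈ S₀, derivZ K K[X] s ∈ acl K S₀) (hF : fracIter f ∈ acl K S₀) :
    ¬ AlgebraicIndependent K fun n => (derivZ K K)^[n] (iterLog f) := by
  have := algebraRat.charZero K
  have hinj : Function.Injective (algebraMap K K[X]⟦X⟧) := algebraMap_powerSeries_injective
  obtain ⟨n, hn⟩ := exists_isAlgebraic_of_not_algebraicIndependent hinj
    (not_algebraicIndependent_of_stable hfin hd hF)
  set x := fun i => (derivZ K K[X])^[i] (fracIter f) with hx_def
  set u := fun i => (derivZ K K[X])^[i] (mapEmb K K[X] (iterLog f)) with hu_def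
  have hxs : ∀ i, derivZ K K[X] (x i) = x (i + 1) := fun i =>
    (Function.iterate_succ_apply' _ _ _).symm
  have hus : ∀ i, derivZ K K[X] (u i) = u (i + 1) := fun i =>
    (Function.iterate_succ_apply' _ _ _).symm
  set S := x '' Set.Iio n with hS
  have hSle : ∀ i ≤ n, x i ∈ acl K S := fun i hi => by
    rcases hi.lt_or_eq with h | rfl
    · exact subset_acl S ⟨i, h, rfl⟩
    · exact mem_acl.2 hn
  have hSx : ∀ i, x i ∈ acl K S := by
    refine iterate_derivation_mem_acl (derivZ K K[X]) ?_ (hSle 0 n.zero_le)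
    rintro _ ⟨i, hi, rfl⟩
    rw [hxs]
    exact hSle (i + 1) hi
  set T := S ∪ u '' Set.Iio n with hT
  have hST : S ⊆ acl K T := Set.subset_union_left.trans (subset_acl T)
  have hTx : ∀ i, x i ∈ acl K T := fun i => acl_le_acl hST (hSx i)
  have hTu : ∀ i < n, u i ∈ acl K T := fun i hi => subset_acl T (Or.inr ⟨i, hi, rfl⟩)
  have hflow : ∀ i ≤ n, derivT K (x i) - u i * x 1 ∈ acl K T := by
    intro i hi
    have := iterate_derivation_mul_sub_mem (derivZ K K[X]) (acl K T) i (mapEmb K K[X] (iterLog f)) (x 1)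
      (fun k hk => hTu k (by omega)) (fun k => hTx (k + 1))
    have hJ : derivT K (fracIter f) = mapEmb K K[X] (iterLog f) * x 1 := derivT_fracIter hf
    rwa [hx_def, derivT_iterate_derivZ, hJ]
  -- F^(n) is algebraic over S, so ∂/∂t of it is controlled by ∂/∂t of the lower F^(i), which
  -- involve only h^(k) with k < n.
  have hxn : derivT K (x n) ∈ acl K T := by
    refine derivation_mem_acl (derivT K) hST ?_ (hSx n)
    rintro _ ⟨i, hi, rfl⟩
    have hi' : i < n := hi
    simpa using add_mem (hflow i hi'.le) (mul_mem (hTu i hi') (hTx 1))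
  -- Comparison with `hflow` at n isolates h^(n)F', and F' ≠ 0.
  have hun : u n ∈ acl K T := by
    refine mem_acl_of_mul_mem (hTx 1) (derivative_fracIter_ne_zero hf) ?_
    rw [mul_comm]
    simpa using sub_mem hxn (hflow n le_rfl)
  have hTle : ∀ i ≤ n, u i ∈ acl K T := fun i hi => by
    rcases hi.lt_or_eq with h | rfl
    · exact hTu i h
    · exact hun
  have hmain := not_algebraicIndependent_of_stable (S := T) (y := mapEmb K K[X] (iterLog f))
    (((Set.finite_Iio n).image _).union ((Set.finite_Iio n).image _)) (by
      rintro s (⟨i, hi, rfl⟩ | ⟨i, hi, rfl⟩)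
      · rw [hxs]
        exact hTx (i + 1)
      · rw [hus]
        exact hTle (i + 1) hi) (hTle 0 n.zero_le)
  intro H
  refine hmain ?_
  simp only [iterate_derivZ_mapEmb]
  exact H.map' mapEmb_injective

theorem not_algebraicIndependent_iterLog_of_isDiffAlgOver (hf : IsUnitary f)
    (h : IsDiffAlgOver (polyEmb K[X]) (fracIter f)) :
    ¬ AlgebraicIndependent K fun n => (derivZ K K)^[n] (iterLog f) := by
  obtain ⟨S, hS, hd, hF⟩ := exists_stable_of_isDiffAlgOver (K := K)
    (c := {(PowerSeries.X : K[X]⟦X⟧), PowerSeries.C (Polynomial.X : K[X])})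
    (Polynomial.coe_injective K[X]) (Set.toFinite _)
    (fun r => adjoin_le_acl _ (coe_mem_adjoin_X_t r)) (by
      rintro s (rfl | rfl)
      · rw [derivZ_apply, PowerSeries.derivative_X]
        exact one_mem _
      · rw [derivZ_apply, PowerSeries.derivative_C]
        exact zero_mem _) h
  exact not_algebraicIndependent_iterLog hf hS hd hF

theorem not_algebraicIndependent_of_isDiffAlgOver_polyEmb {y : K⟦X⟧}
    (h : IsDiffAlgOver (polyEmb K) y) :
    ¬ AlgebraicIndependent K fun n => (derivZ K K)^[n] y := by
  have := algebraRat.charZero K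
  obtain ⟨S, hS, hd, hy⟩ := exists_stable_of_isDiffAlgOver (K := K)
    (c := {(PowerSeries.X : K⟦X⟧)}) (Polynomial.coe_injective K) (Set.toFinite _)
    (fun r => adjoin_le_acl _ (coe_mem_adjoin_X r)) (by
      rintro s rfl
      rw [derivZ_apply, PowerSeries.derivative_X]
      exact one_mem _) h
  exact not_algebraicIndependent_of_stable hS hd hy

end Main

end

end FormalIteration

theorem mainTheorem4 {K : Type*} [CommRing K] [IsDomain K] [Algebra ℚ K]
    (f : PowerSeries K) (hf : FormalIteration.IsUnitary f) :
    (FormalIteration.IsDiffAlgOver (FormalIteration.polyEmb K) (FormalIteration.iterLog f) ↔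
      FormalIteration.IsDiffAlgOver (FormalIteration.polyEmbT K) (FormalIteration.fracIter f)) ∧
    (FormalIteration.IsDiffAlgOver (FormalIteration.polyEmbT K) (FormalIteration.fracIter f) ↔
      FormalIteration.IsDiffAlgOver (FormalIteration.polyEmb (Polynomial K))
        (FormalIteration.fracIter f)) ∧
    (FormalIteration.IsDiffAlgOver (FormalIteration.polyEmb (Polynomial K))
        (FormalIteration.fracIter f) ↔
      FormalIteration.IsDiffAlgOver (FormalIteration.constEmb (Polynomial K))
        (FormalIteration.fracIter f)) := by
  have h31 : FormalIteration.IsDiffAlgOver (FormalIteration.polyEmb (Polynomial K))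
      (FormalIteration.fracIter f) →
      ¬ AlgebraicIndependent K fun n =>
        (FormalIteration.derivZ K K)^[n] (FormalIteration.iterLog f) :=
    FormalIteration.not_algebraicIndependent_iterLog_of_isDiffAlgOver hf
  have h1F : FormalIteration.IsDiffAlgOver (FormalIteration.polyEmb K)
      (FormalIteration.iterLog f) →
      ¬ AlgebraicIndependent K fun n =>
        (FormalIteration.derivZ K (Polynomial K))^[n] (FormalIteration.fracIter f) := fun h =>
    FormalIteration.not_algebraicIndependent_fracIter hf
      (FormalIteration.not_algebraicIndependent_of_isDiffAlgOver_polyEmb h)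
  have h23 := FormalIteration.isDiffAlgOver_polyEmb_of_polyEmbT (y := FormalIteration.fracIter f)
  have h43 := FormalIteration.isDiffAlgOver_polyEmb_of_constEmb (y := FormalIteration.fracIter f)
  have hK1 := FormalIteration.isDiffAlgOver_polyEmb_of_not_algebraicIndependent
    (y := FormalIteration.iterLog f)
  have h3F := fun h => FormalIteration.not_algebraicIndependent_fracIter hf (h31 h)
  have hK2 := FormalIteration.isDiffAlgOver_polyEmbT_of_not_algebraicIndependent
    (y := FormalIteration.fracIter f)
  have hK4 := FormalIteration.isDiffAlgOver_constEmb_of_not_algebraicIndependent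
    (y := FormalIteration.fracIter f)
  -- Conditions 2 and 4 give 3 by enlarging the base; 3 gives dependence over K for h, hence for F,
  -- and this descends to every base.
  exact ⟨⟨fun h => hK2 (h1F h), fun h => hK1 (h31 (h23 h))⟩,
    ⟨h23, fun h => hK2 (h3F h)⟩, ⟨fun h => hK4 (h3F h), h43⟩⟩
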